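/- Let $K$ be a field of characteristic zero, let $n\ge 2$, and let $C\in K[x_1,\ldots,x_{n+1}]$ be a non-constant polynomial. Let $P_C[x_1,\ldots,x_{n+1}]$ be the $n$-Lie-Poisson algebra whose underlying commutative algebra is $K[x_1,\ldots,x_{n+1}]$ and whose bracket is $$\{f_1,\ldots,f_n\}=J(f_1,\ldots,f_n,C),\qquad J(g_1,\ldots,g_{n+1})=\det\left[\frac{\partial g_i}{\partial x_j}\right]_{1\le i,j\le n+1}.$$ Its center is $Z(P_C[x_1,\ldots,x_{n+1}])=\{a : \{a,f_2,\ldots,f_n\}=0 \text{ for all } f_2,\ldots,f_n\in K[x_1,\ldots,x_{n+1}]\}$. A polynomial $g\in K[x_1,\ldots,x_{n+1}]$ is called a root of $C$ if $C\in K[g]$, and a minimal root of $C$ is a root of $C$ of minimal degree. Let $c$ be a minimal root of $C$. Then $$Z(P_C[x_1,\ldots,x_{n+1}])=K[c].$$ -/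

import Mathlib

/-- An `n`-Lie-Poisson algebra structure (`n ≥ 1`) on a commutative associative `K`-algebra `A`:
a skew-symmetric `n`-linear bracket which satisfies the Jacobi (Filippov) identity and is a
derivation in every argument. `Function.update u i a` is the tuple `u` with `i`-th entry replaced
by `a`; slots are numbered from `0`. -/
structure NLiePoissonAlgebra (K A : Type*) [Field K] [CommRing A] [Algebra K A]
    (n : ℕ) [NeZero n] where
  /-- the bracket `{a₁, …, aₙ}` -/
  bracket : A [⋀^Fin n]→ₗ[K] A
  /-- `{{u₁, …, uₙ}, v₁, …, vₙ₋₁} = ∑ᵢ {u₁, …, {uᵢ, v₁, …, vₙ₋₁}, …, uₙ}`; the `v`'s are the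
  entries of `v` outside slot `0`, and entry `v 0` is overwritten. -/
  jacobi : ∀ u v : Fin n → A,
    bracket (Function.update v 0 (bracket u)) =
      ∑ i, bracket (Function.update u i (bracket (Function.update v 0 (u i))))
  /-- the Leibniz identity in the `i`-th argument -/
  leibniz : ∀ (u : Fin n → A) (i : Fin n) (a b : A),
    bracket (Function.update u i (a * b)) =
      a * bracket (Function.update u i b) + bracket (Function.update u i a) * b

/-- The center `Z(P)`: all `a` with `{a, f₂, …, fₙ} = 0` for all `f₂, …, fₙ`. -/
def NLiePoissonAlgebra.center {K A : Type*} [Field K] [CommRing A] [Algebra K A]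
    {n : ℕ} [NeZero n] (P : NLiePoissonAlgebra K A n) : Set A :=
  {a | ∀ f : Fin n → A, P.bracket (Function.update f 0 a) = 0}

namespace JacobianPoisson

/-- The tuple `(f₁, …, fₙ, C)`. -/
def appendLast {A : Type*} {n : ℕ} (f : Fin n → A) (C : A) : Fin (n + 1) → A :=
  Fin.snoc (α := fun _ => A) f C

/-- The Jacobian matrix `(∂ fᵢ / ∂ xⱼ)`. -/
noncomputable def jacobianMatrix {K : Type*} [Field K] {N : ℕ}
    (f : Fin N → MvPolynomial (Fin N) K) : Matrix (Fin N) (Fin N) (MvPolynomial (Fin N) K) :=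
  Matrix.of fun i j => MvPolynomial.pderiv j (f i)

/-- The Jacobian `J(f₁, …, f_N) = det (∂ fᵢ / ∂ xⱼ)`. -/
noncomputable def jacobian {K : Type*} [Field K] {N : ℕ}
    (f : Fin N → MvPolynomial (Fin N) K) : MvPolynomial (Fin N) K :=
  (jacobianMatrix f).det

section Auxiliary

variable {K : Type*} [Field K] {N : ℕ}

theorem jacobianMatrix_update (f : Fin N → MvPolynomial (Fin N) K) (i : Fin N)
    (g : MvPolynomial (Fin N) K) :
    jacobianMatrix (Function.update f i g) =
      (jacobianMatrix f).updateRow i (fun j => MvPolynomial.pderiv j g) := by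
  ext a b : 2
  by_cases h : a = i
  · subst h; simp [jacobianMatrix]
  · simp [jacobianMatrix, Matrix.updateRow_ne h, Function.update_of_ne h]

theorem jacobian_update (f : Fin N → MvPolynomial (Fin N) K) (i : Fin N)
    (g : MvPolynomial (Fin N) K) :
    jacobian (Function.update f i g) =
      ∑ j, MvPolynomial.pderiv j g * (jacobianMatrix f).adjugate j i := by
  rw [jacobian, jacobianMatrix_update, ← Matrix.cramer_transpose_apply,
    Matrix.cramer_eq_adjugate_mulVec, ← Matrix.adjugate_transpose]
  simp [Matrix.mulVec, dotProduct, mul_comm]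

theorem jacobian_update_add (f : Fin N → MvPolynomial (Fin N) K) (i : Fin N)
    (g h : MvPolynomial (Fin N) K) :
    jacobian (Function.update f i (g + h)) =
      jacobian (Function.update f i g) + jacobian (Function.update f i h) := by
  simp [jacobian_update, add_mul, Finset.sum_add_distrib]

theorem jacobian_update_smul (f : Fin N → MvPolynomial (Fin N) K) (i : Fin N) (a : K)
    (g : MvPolynomial (Fin N) K) :
    jacobian (Function.update f i (a • g)) = a • jacobian (Function.update f i g) := by
  simp [jacobian_update, Finset.smul_sum]

theorem jacobian_update_mul (f : Fin N → MvPolynomial (Fin N) K) (i : Fin N)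
    (g h : MvPolynomial (Fin N) K) :
    jacobian (Function.update f i (g * h)) =
      g * jacobian (Function.update f i h) + jacobian (Function.update f i g) * h := by
  simp only [jacobian_update, Finset.mul_sum, Finset.sum_mul, ← Finset.sum_add_distrib]
  refine Finset.sum_congr rfl fun j _ => ?_
  rw [MvPolynomial.pderiv_mul]; ring

theorem jacobian_eq_zero (f : Fin N → MvPolynomial (Fin N) K) {i j : Fin N}
    (h : f i = f j) (hij : i ≠ j) : jacobian f = 0 :=
  Matrix.det_zero_of_row_eq hij (by ext k : 1; simp [jacobianMatrix, h])

theorem derivation_prod {R A : Type*} [CommRing R] [CommRing A] [Algebra R A]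
    (D : Derivation R A A) {ι : Type*} [DecidableEq ι] (s : Finset ι) (g : ι → A) :
    D (∏ i ∈ s, g i) = ∑ i ∈ s, ∏ j ∈ s, Function.update g i (D (g i)) j := by
  induction s using Finset.induction_on with
  | empty => simp
  | insert a s ha ih =>
    rw [Finset.prod_insert ha, D.leibniz, ih, Finset.sum_insert ha, Finset.prod_insert ha,
      Function.update_self, smul_eq_mul, smul_eq_mul, add_comm, Finset.mul_sum]
    congr 1
    · rw [mul_comm]
      congr 1
      exact Finset.prod_congr rfl fun j hj => by
        rw [Function.update_of_ne (fun e : j = a => ha (e ▸ hj))]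
    · refine Finset.sum_congr rfl fun i hi => ?_
      rw [Finset.prod_insert ha, Function.update_of_ne (fun e : a = i => ha (e ▸ hi))]

theorem derivation_det {R A : Type*} [CommRing R] [CommRing A] [Algebra R A]
    (D : Derivation R A A) (M : Matrix (Fin N) (Fin N) A) :
    D M.det = ∑ i, (M.updateRow i fun j => D (M i j)).det := by
  simp only [← Matrix.det_transpose M, ← Matrix.det_transpose (Matrix.updateRow _ _ _)]
  simp only [Matrix.det_apply, map_sum]
  rw [Finset.sum_comm]
  refine Finset.sum_congr rfl fun σ _ => ?_
  rw [← Finset.smul_sum]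
  have : ∀ (z : ℤˣ) (a : A), D (z • a) = z • D a := fun z a => by
    rcases Int.units_eq_one_or z with h | h <;> simp [h]
  rw [this, derivation_prod]
  congr 1
  refine Finset.sum_congr rfl fun i _ => Finset.prod_congr rfl fun j _ => ?_
  by_cases h : j = i
  · subst h; simp
  · simp [Function.update_of_ne h, Matrix.updateRow_ne h]

theorem sum_det_updateRow_mul {A : Type*} [CommRing A] (M B : Matrix (Fin N) (Fin N) A) :
    ∑ i, (M.updateRow i ((M * B) i)).det = B.trace * M.det := by
  have h : ∀ i, (M.updateRow i ((M * B) i)).det = (M * B * M.adjugate) i i := fun i => by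
    rw [← Matrix.cramer_transpose_apply, Matrix.cramer_eq_adjugate_mulVec,
      ← Matrix.adjugate_transpose]
    simp [Matrix.mulVec, dotProduct, Matrix.mul_apply (M := M * B), mul_comm]
  simp only [h]
  change Matrix.trace (M * B * M.adjugate) = _
  rw [Matrix.trace_mul_comm, ← mul_assoc, Matrix.adjugate_mul]
  simp [mul_comm]

theorem pderiv_comm (i j : Fin N) (f : MvPolynomial (Fin N) K) :
    MvPolynomial.pderiv i (MvPolynomial.pderiv j f) =
      MvPolynomial.pderiv j (MvPolynomial.pderiv i f) := by
  have : ⁅(MvPolynomial.pderiv i : Derivation K (MvPolynomial (Fin N) K) (MvPolynomial (Fin N) K)),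
      (MvPolynomial.pderiv j : Derivation K (MvPolynomial (Fin N) K) (MvPolynomial (Fin N) K))⁆ = 0 := by
    apply MvPolynomial.derivation_ext
    intro k
    simp [Derivation.commutator_apply, MvPolynomial.pderiv_X, Pi.single_apply, apply_ite]
  have h := DFunLike.congr_fun this f
  simpa [Derivation.commutator_apply, sub_eq_zero] using h

theorem divergence_adjugate (w : Fin N → MvPolynomial (Fin N) K) (k : Fin N) :
    ∑ j, MvPolynomial.pderiv j ((jacobianMatrix w).adjugate j k) = 0 := by
  simp only [Matrix.adjugate_apply, derivation_det]
  rw [Finset.sum_comm]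
  refine Finset.sum_eq_zero fun i _ => ?_
  by_cases hik : i = k
  · subst hik
    refine Finset.sum_eq_zero fun j _ => Matrix.det_eq_zero_of_row_eq_zero i fun l => ?_
    by_cases hl : l = j <;> simp [Pi.single_apply, hl]
  · set M := jacobianMatrix w with hM
    have key : ∀ j, ((M.updateRow k (Pi.single j 1)).updateRow i fun l =>
        MvPolynomial.pderiv j (M.updateRow k (Pi.single j 1) i l)).det =
        ∑ l, MvPolynomial.pderiv j (M i l) *
          ((M.updateRow k (Pi.single j 1)).updateRow i (Pi.single l 1)).det := fun j => by
      rw [← Matrix.cramer_transpose_apply, Matrix.cramer_eq_adjugate_mulVec,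
        ← Matrix.adjugate_transpose]
      simp [Matrix.mulVec, dotProduct, Matrix.updateRow_ne hik, Matrix.adjugate_apply, mul_comm]
    simp only [key]
    rw [← Finset.sum_product']
    have anti : ∀ j l, ((M.updateRow k (Pi.single j 1)).updateRow i (Pi.single l 1)).det =
        -((M.updateRow k (Pi.single l 1)).updateRow i (Pi.single j 1)).det := fun j l => by
      have e : (M.updateRow k (Pi.single l 1)).updateRow i (Pi.single j 1) =
          ((M.updateRow k (Pi.single j 1)).updateRow i (Pi.single l 1)).submatrix
            (Equiv.swap i k) id := by
        ext a b : 2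
        by_cases ha : a = i
        · subst ha; simp [Matrix.updateRow_ne (Ne.symm hik)]
        · by_cases hb : a = k
          · subst hb; simp [Matrix.updateRow_ne ha]
          · simp [Matrix.updateRow_ne ha, Matrix.updateRow_ne hb, Equiv.swap_apply_of_ne_of_ne ha hb]
      rw [e, Matrix.det_permute, Equiv.Perm.sign_swap hik]
      simp
    have sym : ∀ j l, MvPolynomial.pderiv j (M i l) = MvPolynomial.pderiv l (M i j) := fun j l => by
      simp only [hM, jacobianMatrix, Matrix.of_apply]
      exact pderiv_comm j l _
    refine Finset.sum_involution (fun p _ => p.swap) ?_ ?_ ?_ ?_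
    · rintro ⟨j, l⟩ _
      simp only [Prod.fst_swap, Prod.snd_swap]
      rw [anti l j, sym l j]; ring
    · rintro ⟨j, l⟩ _ hne heq
      simp only [Prod.swap_prod_mk, Prod.mk.injEq] at heq
      apply hne
      obtain ⟨rfl, -⟩ := heq
      rw [Matrix.det_zero_of_row_eq hik, mul_zero]
      simp [Matrix.updateRow_ne (Ne.symm hik)]
    · simp
    · simp

theorem jacobian_filippov (u w : Fin N → MvPolynomial (Fin N) K) (k : Fin N) :
    jacobian (Function.update w k (jacobian u)) =
      ∑ i, jacobian (Function.update u i (jacobian (Function.update w k (u i)))) := by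
  set a : Fin N → MvPolynomial (Fin N) K := fun j => (jacobianMatrix w).adjugate j k with ha
  set B : Matrix (Fin N) (Fin N) (MvPolynomial (Fin N) K) :=
    Matrix.of fun j l => MvPolynomial.pderiv l (a j) with hB
  have htr : B.trace = 0 := divergence_adjugate w k
  set M := jacobianMatrix u with hM
  have hD : ∀ f, jacobian (Function.update w k f) = ∑ j, a j * MvPolynomial.pderiv j f :=
    fun f => by rw [jacobian_update]; simp [ha, mul_comm]
  have hrow : ∀ i, (fun l => MvPolynomial.pderiv l (jacobian (Function.update w k (u i)))) =
      (∑ j, a j • fun l => MvPolynomial.pderiv j (M i l)) + (M * B) i := fun i => by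
    ext1 l
    rw [hD]
    simp only [map_sum, MvPolynomial.pderiv_mul, Finset.sum_add_distrib, Pi.add_apply,
      Finset.sum_apply, Pi.smul_apply, smul_eq_mul, Matrix.mul_apply, hM, hB, jacobianMatrix,
      Matrix.of_apply]
    rw [add_comm]
    congr 1
    · exact Finset.sum_congr rfl fun j _ => by rw [pderiv_comm]
    · exact Finset.sum_congr rfl fun j _ => mul_comm _ _
  have hlin : ∀ i, (M.updateRow i (∑ j, a j • fun l => MvPolynomial.pderiv j (M i l))).det =
      ∑ j, a j * (M.updateRow i fun l => MvPolynomial.pderiv j (M i l)).det := fun i => by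
    simp only [← Matrix.cramer_transpose_apply, map_sum, map_smul, Finset.sum_apply,
      Pi.smul_apply, smul_eq_mul]
  rw [hD, jacobian, ← hM]
  simp only [derivation_det, Finset.mul_sum]
  rw [Finset.sum_comm]
  simp only [← hlin]
  have hR : ∀ i, jacobian (Function.update u i (jacobian (Function.update w k (u i)))) =
      (M.updateRow i (∑ j, a j • fun l => MvPolynomial.pderiv j (M i l))).det +
        (M.updateRow i ((M * B) i)).det := fun i => by
    rw [jacobian, jacobianMatrix_update, hrow, Matrix.det_updateRow_add]
  simp only [hR, Finset.sum_add_distrib, sum_det_updateRow_mul, htr, zero_mul, add_zero]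

theorem appendLast_update {A : Type*} {n : ℕ} (f : Fin n → A) (C : A) (i : Fin n) (a : A) :
    appendLast (Function.update f i a) C =
      Function.update (appendLast f C) i.castSucc a := by
  simp only [appendLast, Fin.snoc_update]

theorem appendLast_castSucc {A : Type*} {n : ℕ} (f : Fin n → A) (C : A) (i : Fin n) :
    appendLast f C i.castSucc = f i := by simp [appendLast]

theorem appendLast_last {A : Type*} {n : ℕ} (f : Fin n → A) (C : A) :
    appendLast f C (Fin.last n) = C := by simp [appendLast]

end Auxiliary

/-- The `n`-Lie-Poisson algebra `P_C[x₁, …, xₙ₊₁]`: the polynomial algebra with bracket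
`{f₁, …, fₙ} = J(f₁, …, fₙ, C)`. -/
noncomputable def PC {K : Type*} [Field K] (n : ℕ) [NeZero n]
    (C : MvPolynomial (Fin (n + 1)) K) :
    NLiePoissonAlgebra K (MvPolynomial (Fin (n + 1)) K) n where
  bracket :=
    { toFun := fun f => jacobian (appendLast f C)
      map_update_add' := fun f i g h => by
        rename_i inst
        obtain rfl : inst = instDecidableEqFin n := Subsingleton.elim _ _
        simp only [appendLast_update, jacobian_update_add]
      map_update_smul' := fun f i a g => by
        rename_i inst
        obtain rfl : inst = instDecidableEqFin n := Subsingleton.elim _ _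
        simp only [appendLast_update, jacobian_update_smul]
      map_eq_zero_of_eq' := fun f i j h hij =>
        jacobian_eq_zero _ (i := i.castSucc) (j := j.castSucc) (by simpa [appendLast_castSucc] using h) (by simpa using hij) }
  jacobi := fun u v => by
    change jacobian (appendLast (Function.update v 0 (jacobian (appendLast u C))) C) =
      ∑ i, jacobian (appendLast (Function.update u i
        (jacobian (appendLast (Function.update v 0 (u i)) C))) C)
    simp only [appendLast_update]
    rw [jacobian_filippov, Fin.sum_univ_castSucc]
    have h0 : jacobian (Function.update
        (appendLast v C) (Fin.castSucc 0) C) = 0 :=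
      jacobian_eq_zero _ (i := Fin.castSucc 0) (j := Fin.last n)
        (by rw [Function.update_self, Function.update_of_ne (Fin.castSucc_lt_last (0 : Fin n)).ne',
              appendLast_last])
        (Fin.castSucc_lt_last _).ne
    have hz : ∀ (f : Fin (n + 1) → MvPolynomial (Fin (n + 1)) K) (i : Fin (n + 1)),
        jacobian (Function.update f i 0) = 0 := fun f i => by simp [jacobian_update]
    simp only [appendLast_last, appendLast_castSucc, h0, hz, add_zero]
  leibniz := fun u i a b => by
    change jacobian (appendLast (Function.update u i (a * b)) C) =
      a * jacobian (appendLast (Function.update u i b) C) +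
        jacobian (appendLast (Function.update u i a) C) * b
    simp only [appendLast_update, jacobian_update_mul]

end JacobianPoisson

/-- `g` is a root of `f`: `f ∈ K[g]`. -/
def IsPolyRoot {K σ : Type*} [Field K] (g f : MvPolynomial σ K) : Prop :=
  f ∈ Algebra.adjoin K {g}

/-- A minimal root of `f` is a root of `f` of minimal (total) degree. -/
def IsMinimalRoot {K σ : Type*} [Field K] (g f : MvPolynomial σ K) : Prop :=
  IsPolyRoot g f ∧ ∀ h : MvPolynomial σ K, IsPolyRoot h f → g.totalDegree ≤ h.totalDegree

/-! ### Integrally closed subalgebras of `K[t]` -/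

section PolynomialSubalgebra

open Polynomial

/-! Let `A` be the algebra of polynomials whose gradient is parallel to that of `C`. A central
element lies in `A`: bracketing it with coordinate functions yields, up to sign, the 2×2 minors of
its gradient against that of `C`. The heart is that `A = K[g]` for some `g`. `A` is integrally
closed, being the intersection of its fraction field with the polynomial ring. Restriction to a line
through the origin on which `C` is not constant is injective on `A`
(`eq_zero_of_restrictRay_eq_zero`), so `A` embeds in `K[t]`. A Lüroth-type argument on the minimal
polynomial of `t` over `A` then gives one generator (`exists_adjoin_singleton_eq_top`). The chain
rule gives `K[c] ⊆ Z ⊆ A = K[g]`. Hence `c = q(g)` with `deg c = deg q · deg g`, minimality forces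
`deg q = 1`, and all inclusions are equalities. -/

theorem Polynomial.coeff_coeff_swap {R : Type*} [CommSemiring R] (f : R[X][X]) (i j : ℕ) :
    ((Bivariate.swap (R := R) f).coeff i).coeff j = (f.coeff j).coeff i := by
  induction f using Polynomial.induction_on' with
  | add p q hp hq => simp [hp, hq]
  | monomial n a =>
    induction a using Polynomial.induction_on' with
    | add p q hp hq => simp only [map_add, coeff_add, hp, hq]
    | monomial m r =>
      rw [Bivariate.swap_monomial_monomial]
      simp only [coeff_monomial]
      split_ifs <;> simp_all [coeff_monomial]

/-- A polynomial `f(t, T)` dividing `p(T) - p(t)`, where `p` is a non-constant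
coefficient of `f`, is a scalar multiple of `p(T) - p(t)`. -/
theorem Polynomial.eq_map_sub_C_of_coeff_dvd {K : Type*} [Field K] {f : K[X][X]}
    {i : ℕ} (hi : (f.coeff i).natDegree ≠ 0)
    (hdvd : f ∣ (f.coeff i).map C - C (f.coeff i)) :
    ∃ k : K, f = (k • f.coeff i).map C - C (k • f.coeff i) := by
  obtain ⟨h, hh⟩ := hdvd
  set p := f.coeff i with hp
  have hp0 : p ≠ 0 := fun h0 => hi (by simp [h0])
  have hdeg : (p.map (C : K →+* K[X])).natDegree = p.natDegree :=
    natDegree_map_eq_of_injective C_injective p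
  -- After the swap, `natDegree` measures the degree in `t`.
  have hs : C p - p.map C = Bivariate.swap (R := K) f * Bivariate.swap (R := K) h := by
    rw [← map_mul, ← hh, map_sub, Bivariate.swap_C, Bivariate.swap_map_C]
  have hlt : (C p : K[X][X]).natDegree < (p.map (C : K →+* K[X])).natDegree := by
    rw [hdeg, natDegree_C]; omega
  have hL : (C p - p.map C).natDegree = p.natDegree := by
    rw [natDegree_sub_eq_right_of_natDegree_lt hlt, hdeg]
  have hne : C p - p.map C ≠ 0 := fun h0 => hi (by rw [← hL, h0, natDegree_zero])
  have hsf : Bivariate.swap (R := K) f ≠ 0 := fun h0 => hne (by rw [hs, h0, zero_mul])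
  have hsh : Bivariate.swap (R := K) h ≠ 0 := fun h0 => hne (by rw [hs, h0, mul_zero])
  -- `p` is a coefficient of `f`, so `f` already uses up the whole `t`-degree of the product; the
  -- cofactor is free of `t`.
  have hle : p.natDegree ≤ (Bivariate.swap (R := K) f).natDegree := by
    refine le_natDegree_of_ne_zero fun h0 => ?_
    have := coeff_coeff_swap f p.natDegree i
    rw [h0, coeff_zero, ← hp, coeff_natDegree] at this
    exact hp0 (leadingCoeff_eq_zero.mp this.symm)
  have hadd : p.natDegree =
      (Bivariate.swap (R := K) f).natDegree + (Bivariate.swap (R := K) h).natDegree := by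
    rw [← natDegree_mul hsf hsh, ← hs, hL]
  obtain ⟨u, hu⟩ := natDegree_eq_zero.mp (show (Bivariate.swap (R := K) h).natDegree = 0 by omega)
  -- The leading coefficient in `t` of `p(T) - p(t)` is a nonzero scalar, so its factor `u`, a
  -- polynomial in `T`, is a unit.
  have hlead : -C p.leadingCoeff = (Bivariate.swap (R := K) f).leadingCoeff * u := by
    have := congrArg leadingCoeff hs
    rw [leadingCoeff_mul, ← hu, leadingCoeff_C, leadingCoeff_sub_of_degree_lt'
      (degree_lt_degree hlt), leadingCoeff_map_of_injective C_injective] at this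
    exact this
  have hunit : IsUnit u := by
    refine isUnit_of_mul_isUnit_right (x := (Bivariate.swap (R := K) f).leadingCoeff) ?_
    rw [← hlead, IsUnit.neg_iff, isUnit_C]
    exact (leadingCoeff_ne_zero.mpr hp0).isUnit
  obtain ⟨k, hk, rfl⟩ := isUnit_iff.mp hunit
  have hh' : h = C (C k) := by
    rw [← Bivariate.swap_swap_apply h, ← hu, Bivariate.swap_C_C]
  refine ⟨k⁻¹, ?_⟩
  have hk0 : k ≠ 0 := hk.ne_zero
  rw [smul_eq_C_mul, Polynomial.map_mul, C_mul, map_C, ← mul_sub, hh, hh', mul_comm, mul_assoc,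
    ← C_mul, ← C_mul, mul_inv_cancel₀ hk0]
  simp

/-- An integrally closed algebra which embeds into `K[t]`, and is not made of constants, is
generated by one element. -/
theorem exists_adjoin_singleton_eq_top {K A : Type*} [Field K] [CommRing A] [IsDomain A]
    [Algebra K A] [IsIntegrallyClosed A] (φ : A →ₐ[K] K[X]) (hφ : Function.Injective φ)
    (a₀ : A) (h₀ : (φ a₀).natDegree ≠ 0) : ∃ g : A, Algebra.adjoin K {g} = ⊤ := by
  let _ : Algebra A K[X] := φ.toRingHom.toAlgebra
  have halg : ∀ a, algebraMap A K[X] a = φ a := fun _ => rfl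
  have _ : FaithfulSMul A K[X] := (faithfulSMul_iff_algebraMap_injective A K[X]).mpr hφ
  have hcomp : (algebraMap A K[X]).comp (algebraMap K A) = C := by
    ext k : 1; simp [halg]
  have hroot : ∀ a : A, aeval (X : K[X]) ((φ a).map (algebraMap K A) - C a) = 0 := fun a => by
    rw [map_sub, aeval_def, eval₂_map, hcomp, aeval_C, halg, eval₂_C_X, sub_self]
  -- `t` is a root of `φ(a₀)(T) - a₀`, which becomes monic after scaling.
  have hint : IsIntegral A (X : K[X]) := by
    have hlc : (φ a₀).leadingCoeff ≠ 0 := fun h => h₀ (by simp [leadingCoeff_eq_zero.mp h])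
    have hdeg : (C a₀ : A[X]).degree < ((φ a₀).map (algebraMap K A)).degree := by
      refine degree_lt_degree ?_
      rw [natDegree_C, natDegree_map]; omega
    have hl : ((φ a₀).map (algebraMap K A) - C a₀).leadingCoeff =
        algebraMap K A (φ a₀).leadingCoeff := by
      rw [leadingCoeff_sub_of_degree_lt hdeg, leadingCoeff_map]
    refine ⟨C (algebraMap K A (φ a₀).leadingCoeff⁻¹) * ((φ a₀).map (algebraMap K A) - C a₀),
      ?_, ?_⟩
    · rw [Monic, leadingCoeff_mul, leadingCoeff_C, hl, ← map_mul, inv_mul_cancel₀ hlc, map_one]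
    · rw [← aeval_def, map_mul, hroot, mul_zero]
  set F := minpoly A (X : K[X])
  obtain ⟨f, hfdef⟩ : ∃ f : K[X][X], f = F.map (algebraMap A K[X]) := ⟨_, rfl⟩
  have hf : f.Monic := hfdef ▸ (minpoly.monic hint).map _
  -- Integral closedness enters here: the minimal polynomial divides every polynomial over `A` that
  -- vanishes at `t`.
  have hdvd : ∀ a : A, f ∣ (φ a).map C - C (φ a) := fun a => by
    have := Polynomial.map_dvd (algebraMap A K[X])
      (minpoly.isIntegrallyClosed_dvd hint (hroot a))
    rwa [Polynomial.map_sub, map_map, hcomp, map_C, halg, ← hfdef] at this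
  -- Otherwise `t` would be algebraic over `K`.
  obtain ⟨i, hi⟩ : ∃ i, (f.coeff i).natDegree ≠ 0 := by
    by_contra! hcon
    have hC : f = (f.map (constantCoeff (R := K))).map C := by
      ext1 j
      rw [coeff_map, coeff_map, constantCoeff_apply]
      exact eq_C_of_natDegree_eq_zero (hcon j)
    have h0 : f.eval X = 0 := by
      rw [hfdef, eval_map_algebraMap, minpoly.aeval]
    rw [hC, eval_map, eval₂_C_X] at h0
    rw [h0, Polynomial.map_zero] at hC
    exact hf.ne_zero hC
  have hcoeff : f.coeff i = φ (F.coeff i) := by rw [hfdef, coeff_map, halg]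
  obtain ⟨k, hk⟩ := eq_map_sub_C_of_coeff_dvd hi (by rw [hcoeff]; exact hdvd _)
  refine ⟨k • F.coeff i, eq_top_iff.mpr fun a _ => ?_⟩
  set p := k • f.coeff i with hp
  have hpg : φ (k • F.coeff i) = p := by rw [map_smul, hp, hcoeff]
  let B := Algebra.adjoin K {p}
  let G : B[X] := p.map (algebraMap K B) - C ⟨p, Algebra.self_mem_adjoin_singleton K p⟩
  have hBinj : Function.Injective (algebraMap B K[X]) := Subtype.val_injective
  have hG : G.map (algebraMap B K[X]) = f := by
    rw [Polynomial.map_sub, map_map, map_C, hk]; rfl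
  have hGm : G.Monic := hBinj.monic_map_iff.mpr (hG ▸ hf)
  -- Modulo `f`, the remainder of `φ(a)(T)` is `φ(a)(t)`. Since `f = p(T) - p(t)` is monic over `B =
  -- K[p]`, the same division runs over `B`, so `φ(a)` lies in `B`.
  have hmod : (((φ a).map (algebraMap K B)) %ₘ G).map (algebraMap B K[X]) = C (φ a) := by
    rw [map_modByMonic _ hGm, hG, map_map]
    change (φ a).map C %ₘ f = _
    rw [modByMonic_eq_of_dvd_sub hf (hdvd a), modByMonic_eq_self_iff hf]
    refine degree_lt_degree ?_
    rw [natDegree_C, Nat.pos_iff_ne_zero]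
    intro h0
    have h1 : f = 1 := hf.natDegree_eq_zero.mp h0
    apply hi
    rw [h1, coeff_one]
    split_ifs <;> simp
  have hmem : φ a ∈ B := by
    have := congrArg (fun q => coeff q 0) hmod
    simp only [coeff_map, coeff_C_zero] at this
    rw [← this]
    exact Subtype.property _
  have hmap : B = (Algebra.adjoin K {k • F.coeff i}).map φ := by
    rw [AlgHom.map_adjoin, Set.image_singleton, hpg]
  rw [hmap] at hmem
  obtain ⟨b, hb, hba⟩ := hmem
  exact hφ hba ▸ hb

end PolynomialSubalgebra

/-! ### Chain rules, and vanishing Jacobians in the plane -/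

namespace MvPolynomial

open Polynomial (derivative)

theorem pderiv_aeval {R σ τ : Type*} [CommRing R] [Fintype σ] (u : σ → MvPolynomial τ R)
    (k : τ) (p : MvPolynomial σ R) :
    pderiv k (aeval u p) = ∑ i, aeval u (pderiv i p) * pderiv k (u i) := by
  classical
  induction p using MvPolynomial.induction_on with
  | C a => simp [algebraMap_eq]
  | add p q hp hq => simp only [map_add, hp, hq, add_mul, Finset.sum_add_distrib]
  | mul_X p j hp =>
    simp only [map_mul, aeval_X, pderiv_mul, hp, map_add, add_mul, Finset.sum_add_distrib]
    congr 1
    · rw [Finset.sum_mul]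
      exact Finset.sum_congr rfl fun i _ => by ring
    · simp [pderiv_X, Pi.single_apply]

theorem pderiv_polynomial_aeval {R σ : Type*} [CommRing R] (k : σ) (g : MvPolynomial σ R)
    (q : Polynomial R) :
    pderiv k (Polynomial.aeval g q) = Polynomial.aeval g (derivative q) * pderiv k g := by
  rw [Derivation.comp_aeval_eq, smul_eq_mul]

section Plane

variable {K : Type*} [Field K]

/-- Restriction of a polynomial in two variables to the line on which the second vanishes. -/
noncomputable def restrictLine : MvPolynomial (Fin 2) K →ₐ[K] Polynomial K :=
  aeval ![Polynomial.X, 0]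

theorem X_one_dvd_sub_restrictLine (A : MvPolynomial (Fin 2) K) :
    X 1 ∣ A - Polynomial.aeval (X 0) (restrictLine A) := by
  rw [← Ideal.mem_span_singleton, ← Ideal.Quotient.eq]
  have : (Ideal.Quotient.mkₐ K (Ideal.span {(X 1 : MvPolynomial (Fin 2) K)})) =
      ((Ideal.Quotient.mkₐ K (Ideal.span {(X 1 : MvPolynomial (Fin 2) K)})).comp
        (Polynomial.aeval (X 0))).comp restrictLine := by
    ext i
    fin_cases i
    all_goals simp [restrictLine]
  exact DFunLike.congr_fun this A

theorem X_one_dvd_iff_restrictLine {A : MvPolynomial (Fin 2) K} :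
    X 1 ∣ A ↔ restrictLine A = 0 := by
  constructor
  · rintro ⟨b, rfl⟩
    simp [restrictLine]
  · intro h
    simpa [h] using X_one_dvd_sub_restrictLine A

theorem restrictLine_pderiv_zero (B : MvPolynomial (Fin 2) K) :
    restrictLine (pderiv 0 B) = derivative (restrictLine B) := by
  obtain ⟨b, hb⟩ := X_one_dvd_sub_restrictLine B
  have h := congrArg (fun p => restrictLine (pderiv 0 p)) hb
  simp only [map_sub, pderiv_polynomial_aeval, pderiv_X_self, mul_one, pderiv_mul,
    map_mul, pderiv_X_of_ne (show (1 : Fin 2) ≠ 0 by decide), zero_mul, zero_add] at h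
  have h1 : restrictLine (X 1 : MvPolynomial (Fin 2) K) = 0 := by simp [restrictLine]
  have h2 : ∀ q : Polynomial K, restrictLine (Polynomial.aeval (X 0) q) = q := fun q => by
    rw [← Polynomial.aeval_algHom_apply]
    simp [restrictLine]
  rw [h1, h2, zero_mul, sub_eq_zero] at h
  exact h

/-- Write `A = y^k b` with `y = X 1` not dividing `b` and `k ≥ 1`. Dividing the relation by
`y^(k-1)` leaves `k b ∂₀B ≡ 0` modulo the prime `y`; as `k` is invertible, `y` divides `∂₀B`,
against `hB`. -/
theorem eq_zero_of_jacobian_eq_zero [CharZero K] {A B : MvPolynomial (Fin 2) K}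
    (h : pderiv 0 A * pderiv 1 B = pderiv 1 A * pderiv 0 B) (hA : restrictLine A = 0)
    (hB : derivative (restrictLine B) ≠ 0) : A = 0 := by
  by_contra hA0
  have hX : Prime (X 1 : MvPolynomial (Fin 2) K) := X_prime
  obtain ⟨k, b, hb, hAb⟩ := WfDvdMonoid.max_power_factor hA0 hX.irreducible
  have hk : k ≠ 0 := by
    rintro rfl
    rw [pow_zero, one_mul] at hAb
    exact hb (hAb ▸ X_one_dvd_iff_restrictLine.mpr hA)
  obtain ⟨m, rfl⟩ := Nat.exists_eq_succ_of_ne_zero hk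
  have hkey : X 1 * (pderiv 0 b * pderiv 1 B) =
      (((m + 1 : ℕ) : MvPolynomial (Fin 2) K) * b + X 1 * pderiv 1 b) * pderiv 0 B := by
    refine mul_left_cancel₀ (pow_ne_zero m hX.ne_zero) ?_
    rw [hAb, pow_succ] at h
    rw [← pow_succ] at h
    simp only [pderiv_mul, pderiv_pow, pderiv_X_self,
      pderiv_X_of_ne (show (1 : Fin 2) ≠ 0 by decide), Nat.add_sub_cancel] at h
    linear_combination h
  have hdvd : X 1 ∣ (C ((m + 1 : ℕ) : K) * b) * pderiv 0 B := by
    refine ⟨pderiv 0 b * pderiv 1 B - pderiv 1 b * pderiv 0 B, ?_⟩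
    rw [map_natCast]
    linear_combination -hkey
  have hm : IsUnit (C ((m + 1 : ℕ) : K) : MvPolynomial (Fin 2) K) :=
    (Nat.cast_ne_zero.mpr m.succ_ne_zero : ((m + 1 : ℕ) : K) ≠ 0).isUnit.map C
  rcases hX.dvd_or_dvd hdvd with h1 | h1
  · exact hb ((hm.dvd_mul_left).mp h1)
  · rw [X_one_dvd_iff_restrictLine, restrictLine_pderiv_zero] at h1
    exact hB h1

end Plane

/-! ### The algebra of parallel gradients has one generator -/

section Gradient

variable {K σ : Type*} [Field K]

/-- The polynomials whose gradient is parallel to the gradient of `f`. -/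
noncomputable def parallelGradient (f : MvPolynomial σ K) :
    Subalgebra K (MvPolynomial σ K) where
  carrier := {a | ∀ i j, pderiv i a * pderiv j f = pderiv j a * pderiv i f}
  mul_mem' {a b} ha hb i j := by
    simp only [pderiv_mul]
    linear_combination b * ha i j + a * hb i j
  add_mem' {a b} ha hb i j := by
    simp only [map_add]
    linear_combination ha i j + hb i j
  algebraMap_mem' r i j := by simp [algebraMap_eq]

theorem self_mem_parallelGradient (f : MvPolynomial σ K) : f ∈ parallelGradient f :=
  fun _ _ => mul_comm _ _

theorem mem_parallelGradient_of_mul_mem {f a b : MvPolynomial σ K} (hb0 : b ≠ 0)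
    (hb : b ∈ parallelGradient f) (hab : a * b ∈ parallelGradient f) :
    a ∈ parallelGradient f := fun i j => by
  have h := hab i j
  simp only [pderiv_mul] at h
  refine mul_right_cancel₀ hb0 ?_
  linear_combination h - a * hb i j

/-- An integral fraction `a / b` is a polynomial `y`, since the polynomial ring is integrally
closed; then `y b = a`, and `mem_parallelGradient_of_mul_mem` puts `y` in the subalgebra. -/
instance (f : MvPolynomial σ K) : IsIntegrallyClosed (parallelGradient f) := by
  refine (isIntegrallyClosed_iff (FractionRing (parallelGradient f))).mpr fun {x} hx => ?_
  obtain ⟨a, b, hb, rfl⟩ := IsFractionRing.div_surjective (A := parallelGradient f) x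
  have hb0 : b ≠ 0 := nonZeroDivisors.ne_zero hb
  let R := MvPolynomial σ K
  have hinj : Function.Injective (algebraMap (parallelGradient f) R) := Subtype.val_injective
  let ι : FractionRing (parallelGradient f) →ₐ[parallelGradient f] FractionRing R :=
    IsFractionRing.liftAlgHom (g := Algebra.ofId (parallelGradient f) (FractionRing R))
      ((IsFractionRing.injective R (FractionRing R)).comp hinj)
  have hy : IsIntegral R (ι (algebraMap _ _ a / algebraMap _ _ b)) := (hx.map ι).tower_top
  obtain ⟨y, hy⟩ := IsIntegrallyClosed.isIntegral_iff.mp hy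
  rw [map_div₀, ι.commutes, ι.commutes,
    IsScalarTower.algebraMap_apply (parallelGradient f) R (FractionRing R) a,
    IsScalarTower.algebraMap_apply (parallelGradient f) R (FractionRing R) b] at hy
  have hb1 : (b : R) ≠ 0 := fun h => hb0 (Subtype.ext h)
  have hb2 : algebraMap R (FractionRing R) b ≠ 0 := fun h =>
    hb1 (IsFractionRing.injective R (FractionRing R) (by rw [h, map_zero]))
  have hyab : y * (b : R) = a := by
    apply IsFractionRing.injective R (FractionRing R)
    rw [map_mul, hy]
    exact div_mul_cancel₀ _ hb2
  refine ⟨⟨y, mem_parallelGradient_of_mul_mem hb1 b.2 (hyab ▸ a.2)⟩, ?_⟩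
  have hb3 : algebraMap (parallelGradient f) (FractionRing (parallelGradient f)) b ≠ 0 := fun h =>
    hb0 (IsFractionRing.injective _ (FractionRing (parallelGradient f)) (by rw [h, map_zero]))
  rw [eq_div_iff hb3, ← map_mul]
  exact congrArg _ (Subtype.ext hyab)

variable [CharZero K]

/-- Restriction of a polynomial to the line through the origin and `v`. -/
noncomputable def restrictRay (v : σ → K) : MvPolynomial σ K →ₐ[K] Polynomial K :=
  aeval fun i => Polynomial.C (v i) * Polynomial.X

/-- Were `f` constant on every line through the origin, then `f(v) = f(0)` for all `v`, and `K` is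
infinite. -/
theorem exists_natDegree_restrictRay_ne_zero {f : MvPolynomial σ K} (hf : ∀ a : K, f ≠ C a) :
    ∃ v : σ → K, (restrictRay v f).natDegree ≠ 0 := by
  by_contra! h
  have hev : ∀ (v : σ → K) (t : K) (p : MvPolynomial σ K),
      (restrictRay v p).eval t = eval (fun i => v i * t) p := fun v t p => by
    induction p using MvPolynomial.induction_on with
    | C a => simp [restrictRay]
    | add p q hp hq => simp [hp, hq]
    | mul_X p j hp => rw [map_mul, Polynomial.eval_mul, hp]; simp [restrictRay]
  refine hf (eval 0 f) (funext fun v => ?_)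
  obtain ⟨a, ha⟩ := Polynomial.natDegree_eq_zero.mp (h v)
  have h1 := hev v 1 f
  have h0 := hev v 0 f
  rw [← ha, Polynomial.eval_C] at h0 h1
  simp only [mul_one, mul_zero] at h0 h1
  rw [eval_C, ← h1, h0]
  rfl

theorem eq_zero_of_restrictRay_eq_zero [Fintype σ] {f : MvPolynomial σ K} {v : σ → K}
    (hv : (restrictRay v f).natDegree ≠ 0) {a : MvPolynomial σ K}
    (ha : a ∈ parallelGradient f) (h0 : restrictRay v a = 0) : a = 0 := by
  by_contra ha0
  obtain ⟨w, hw⟩ : ∃ w, eval w a ≠ 0 := by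
    by_contra! h
    exact ha0 (funext fun w => by rw [h, map_zero])
  -- Pull back along `(x, y) ↦ x v + y w`: the line `y = 0` maps to the ray of `v`, the point `(0,
  -- 1)` to `w`, and parallel gradients give a zero plane Jacobian.
  let u : σ → MvPolynomial (Fin 2) K := fun i => C (v i) * X 0 + C (w i) * X 1
  have hres : ∀ p, restrictLine (aeval u p) = restrictRay v p := fun p => by
    have : (restrictLine.comp (aeval u)) = restrictRay v := by
      ext i : 1
      simp [u, restrictLine, restrictRay]
    exact DFunLike.congr_fun this p
  have hev : eval ![0, 1] (aeval u a) = eval w a := by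
    have : (aeval (R := K) ![(0 : K), 1]).comp (aeval u) = aeval w := by
      ext i : 1
      simp [u]
    simpa [aeval_eq_eval] using DFunLike.congr_fun this a
  have hd0 : ∀ i, pderiv 0 (u i) = C (v i) := fun i => by
    simp [u, pderiv_X]
  have hd1 : ∀ i, pderiv 1 (u i) = C (w i) := fun i => by
    simp [u, pderiv_X]
  have hz : aeval u a = 0 := by
    refine eq_zero_of_jacobian_eq_zero (B := aeval u f) ?_ (by rw [hres, h0]) ?_
    · simp only [pderiv_aeval, hd0, hd1, Finset.sum_mul_sum]
      rw [Finset.sum_comm]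
      refine Finset.sum_congr rfl fun j _ => Finset.sum_congr rfl fun i _ => ?_
      have := congrArg (aeval u) (ha i j)
      simp only [map_mul] at this
      linear_combination C (v i) * C (w j) * this
    · rw [hres]
      intro h
      exact hv (Polynomial.derivative_eq_zero.mp h)
  exact hw (by rw [← hev, hz, map_zero])

theorem exists_parallelGradient_eq_adjoin [Fintype σ] {f : MvPolynomial σ K} (hf : ∀ a : K, f ≠ C a) :
    ∃ g, parallelGradient f = Algebra.adjoin K {g} := by
  obtain ⟨v, hv⟩ := exists_natDegree_restrictRay_ne_zero hf
  obtain ⟨g, hg⟩ := exists_adjoin_singleton_eq_top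
    ((restrictRay v).comp (parallelGradient f).val)
    ((injective_iff_map_eq_zero _).mpr fun a h => Subtype.ext (eq_zero_of_restrictRay_eq_zero hv a.2 h))
    ⟨f, self_mem_parallelGradient f⟩ hv
  refine ⟨g, ?_⟩
  have := congrArg (Subalgebra.map (parallelGradient f).val) hg
  rw [AlgHom.map_adjoin, Set.image_singleton, Algebra.map_top, Subalgebra.range_val] at this
  exact this.symm

end Gradient

/-! ### Degrees of `q(g)` and minimal roots -/

section Degree

variable {K σ : Type*} [Field K]

theorem totalDegree_polynomial_aeval (g : MvPolynomial σ K) (q : Polynomial K) :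
    (Polynomial.aeval g q).totalDegree = q.natDegree * g.totalDegree := by
  by_cases hg : g.totalDegree = 0
  · rw [totalDegree_eq_zero_iff_eq_C.mp hg, ← algebraMap_eq, Polynomial.aeval_algebraMap_apply,
      algebraMap_eq, totalDegree_C, totalDegree_C, mul_zero]
  have hg0 : g ≠ 0 := fun h => hg (by rw [h, totalDegree_zero])
  induction hn : q.natDegree generalizing q with
  | zero =>
    obtain ⟨a, rfl⟩ := Polynomial.natDegree_eq_zero.mp hn
    rw [Polynomial.aeval_C, algebraMap_eq, totalDegree_C, zero_mul]
  | succ n ih =>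
    have hdiv : q.divX.natDegree = n := by rw [Polynomial.natDegree_divX_eq_natDegree_tsub_one, hn]; rfl
    have h := ih q.divX hdiv
    -- If it vanished, the degree formula would give `n = 0`, so `q.divX = 0` and `q` would be
    -- constant.
    have hne : Polynomial.aeval g q.divX ≠ 0 := by
      intro h0
      rw [h0, totalDegree_zero, eq_comm, mul_eq_zero, or_iff_left hg] at h
      subst h
      obtain ⟨a, ha⟩ := Polynomial.natDegree_eq_zero.mp hdiv
      rw [← ha, Polynomial.aeval_C, algebraMap_eq, C_eq_zero] at h0
      rw [h0, map_zero] at ha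
      rw [← Polynomial.divX_mul_X_add q, ← ha, zero_mul, zero_add, Polynomial.natDegree_C] at hn
      omega
    have hmul : (Polynomial.aeval g q.divX * g).totalDegree = (n + 1) * g.totalDegree := by
      rw [totalDegree_mul_of_isDomain hne hg0, h]; ring
    conv_lhs => rw [← Polynomial.divX_mul_X_add q]
    rw [map_add, map_mul, Polynomial.aeval_X, Polynomial.aeval_C, algebraMap_eq,
      totalDegree_add_eq_left_of_totalDegree_lt, hmul]
    rw [hmul, totalDegree_C]
    positivity

/-- A minimal root `c` of `f` in `K[g]`, where `g` is a root of the non-constant `f`, generates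
`K[g]`. -/
theorem adjoin_eq_of_isMinimalRoot {f c g : MvPolynomial σ K} (hf : ∀ a : K, f ≠ C a)
    (hc : IsMinimalRoot c f) (hg : IsPolyRoot g f) (hcg : c ∈ Algebra.adjoin K {g}) :
    Algebra.adjoin K {c} = Algebra.adjoin K {g} := by
  refine le_antisymm (Algebra.adjoin_le (by simpa using hcg)) (Algebra.adjoin_le ?_)
  rw [Set.singleton_subset_iff, SetLike.mem_coe]
  obtain ⟨q, rfl⟩ := Algebra.adjoin_mem_exists_aeval K g hcg
  obtain ⟨r, rfl⟩ := Algebra.adjoin_mem_exists_aeval K _ hc.1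
  have hq1 : q.natDegree ≠ 0 := by
    intro h0
    have : (Polynomial.aeval g q).totalDegree = 0 := by
      rw [totalDegree_polynomial_aeval, h0, zero_mul]
    rw [totalDegree_eq_zero_iff_eq_C.mp this] at hf
    refine hf (r.eval (coeff 0 (Polynomial.aeval g q))) ?_
    rw [← algebraMap_eq, Polynomial.aeval_algebraMap_apply, Polynomial.coe_aeval_eq_eval]
  have hg0 : g.totalDegree ≠ 0 := by
    intro h0
    have : (Polynomial.aeval (Polynomial.aeval g q) r).totalDegree = 0 := by
      rw [totalDegree_polynomial_aeval, totalDegree_polynomial_aeval, h0, mul_zero, mul_zero]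
    exact hf _ (totalDegree_eq_zero_iff_eq_C.mp this)
  have hle := hc.2 g hg
  rw [totalDegree_polynomial_aeval] at hle
  have hq : q.natDegree = 1 := by
    have : q.natDegree ≤ 1 := by
      by_contra! h
      nlinarith [Nat.pos_of_ne_zero hg0]
    omega
  obtain ⟨a, ha, b, rfl⟩ := Polynomial.natDegree_eq_one.mp hq
  have hgen : g = a⁻¹ • (Polynomial.aeval g (Polynomial.C a * Polynomial.X + Polynomial.C b) -
      algebraMap K (MvPolynomial σ K) b) := by
    simp only [map_add, map_mul, Polynomial.aeval_C, Polynomial.aeval_X, add_sub_cancel_right,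
      ← Algebra.smul_def, smul_smul, inv_mul_cancel₀ ha, one_smul]
  have hmem (c : MvPolynomial σ K) : a⁻¹ • (c - algebraMap K (MvPolynomial σ K) b) ∈
      Algebra.adjoin K {c} :=
    Subalgebra.smul_mem _ (Subalgebra.sub_mem _ (Algebra.self_mem_adjoin_singleton K _)
    (Subalgebra.algebraMap_mem _ _)) _
  have h := hmem (Polynomial.aeval g (Polynomial.C a * Polynomial.X + Polynomial.C b))
  rwa [← hgen] at h

end Degree

end MvPolynomial

/-! ### The center between `K[c]` and the parallel gradients -/

namespace JacobianPoisson

open MvPolynomial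

variable {K : Type*} [Field K] {N n : ℕ}

theorem jacobian_update_aeval (f : Fin N → MvPolynomial (Fin N) K) (i : Fin N)
    (g : MvPolynomial (Fin N) K) (q : Polynomial K) :
    jacobian (Function.update f i (Polynomial.aeval g q)) =
      Polynomial.aeval g (Polynomial.derivative q) * jacobian (Function.update f i g) := by
  simp only [jacobian_update, pderiv_polynomial_aeval, Finset.mul_sum, mul_assoc]

theorem PC_bracket [NeZero n] (C : MvPolynomial (Fin (n + 1)) K)
    (f : Fin n → MvPolynomial (Fin (n + 1)) K) :
    (PC n C).bracket f = jacobian (appendLast f C) := rfl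

/-- The chain rule pulls `r'(c)` and `q'(c)` out of the Jacobian, leaving one with `c` in two rows.
-/
theorem mem_center_of_isPolyRoot [NeZero n] {C c a : MvPolynomial (Fin (n + 1)) K}
    (hc : IsPolyRoot c C) (ha : a ∈ Algebra.adjoin K {c}) : a ∈ (PC n C).center := by
  obtain ⟨r, rfl⟩ := Algebra.adjoin_mem_exists_aeval K c ha
  obtain ⟨q, rfl⟩ := Algebra.adjoin_mem_exists_aeval K c hc
  intro f
  have hlast : ∀ b, appendLast f b = Function.update (appendLast f 0) (Fin.last n) b := fun b => by
    simp [appendLast, Fin.update_snoc_last]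
  have hne : (0 : Fin n).castSucc ≠ Fin.last n := (Fin.castSucc_lt_last _).ne
  rw [PC_bracket, appendLast_update, jacobian_update_aeval, hlast,
    Function.update_comm hne.symm, jacobian_update_aeval]
  rw [jacobian_eq_zero _ (i := (0 : Fin n).castSucc) (j := Fin.last n) ?_ hne, mul_zero, mul_zero]
  rw [Function.update_of_ne hne, Function.update_self, Function.update_self]

theorem center_subset_parallelGradient [NeZero n] (C : MvPolynomial (Fin (n + 1)) K) :
    (PC n C).center ⊆ parallelGradient C := by
  intro a ha i j
  rcases eq_or_ne i j with rfl | hij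
  · rfl
  have hne : (0 : Fin n).castSucc ≠ Fin.last n := (Fin.castSucc_lt_last _).ne
  obtain ⟨e, he0, hel⟩ : ∃ e : Equiv.Perm (Fin (n + 1)),
      e (0 : Fin n).castSucc = i ∧ e (Fin.last n) = j := by
    let s := Equiv.swap (0 : Fin n).castSucc i
    refine ⟨s * Equiv.swap (Fin.last n) (s j), ?_, ?_⟩
    · rw [Equiv.Perm.mul_apply, Equiv.swap_apply_of_ne_of_ne hne, Equiv.swap_apply_left]
      intro h
      apply hij
      exact s.injective ((Equiv.swap_apply_right _ _).trans h)
    · rw [Equiv.Perm.mul_apply, Equiv.swap_apply_left]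
      exact DFunLike.congr_fun (Equiv.swap_swap _ i) j
  -- Slot `0` is overwritten by `a`; the others run over the coordinates other than `i` and `j`.
  have h := ha fun k => X (e k.castSucc)
  rw [PC_bracket, jacobian] at h
  -- Instead of expanding the determinant, take a kernel vector: the coordinate rows confine it to
  -- `i` and `j`, so the 2×2 minor of `a` and `C` must vanish.
  obtain ⟨w, hw0, hw⟩ := Matrix.exists_mulVec_eq_zero_iff.mpr h
  have hrow : ∀ k, ∑ l, pderiv l (appendLast (Function.update
      (fun k : Fin n => (X (e k.castSucc) : MvPolynomial (Fin (n + 1)) K)) 0 a) C k) * w l = 0 :=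
    fun k => congrFun hw k
  have hwz : ∀ l, l ≠ i → l ≠ j → w l = 0 := by
    intro l hli hlj
    obtain ⟨k, rfl⟩ := e.surjective l
    induction k using Fin.lastCases with
    | last => exact absurd hel hlj
    | cast k =>
      have hk : k ≠ 0 := by rintro rfl; exact hli he0
      have := hrow k.castSucc
      rw [appendLast_castSucc, Function.update_of_ne hk] at this
      simpa [pderiv_X, Pi.single_apply] using this
  have hpair : ∀ p : MvPolynomial (Fin (n + 1)) K, ∑ l, pderiv l p * w l =
      pderiv i p * w i + pderiv j p * w j := fun p =>
    Fintype.sum_eq_add i j hij fun l hl => by rw [hwz l hl.1 hl.2, mul_zero]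
  have h1 := hrow (0 : Fin n).castSucc
  have h2 := hrow (Fin.last n)
  rw [appendLast_castSucc, Function.update_self, hpair] at h1
  rw [appendLast_last, hpair] at h2
  have hi : (pderiv i a * pderiv j C - pderiv j a * pderiv i C) * w i = 0 := by
    linear_combination pderiv j C * h1 - pderiv j a * h2
  have hj : (pderiv i a * pderiv j C - pderiv j a * pderiv i C) * w j = 0 := by
    linear_combination pderiv i a * h2 - pderiv i C * h1
  rw [← sub_eq_zero]
  by_contra hne0
  refine hw0 (_root_.funext fun l => ?_)
  by_cases hli : l = i
  · rw [hli]; exact (mul_eq_zero.mp hi).resolve_left hne0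
  by_cases hlj : l = j
  · rw [hlj]; exact (mul_eq_zero.mp hj).resolve_left hne0
  exact hwz l hli hlj

end JacobianPoisson

theorem proposition1 {K : Type*} [Field K] [CharZero K] (n : ℕ) [n.AtLeastTwo]
    (C : MvPolynomial (Fin (n + 1)) K) (hC : ∀ a : K, C ≠ MvPolynomial.C a)
    (c : MvPolynomial (Fin (n + 1)) K) (hc : IsMinimalRoot c C) :
    (JacobianPoisson.PC n C).center =
      (Algebra.adjoin K {c} : Set (MvPolynomial (Fin (n + 1)) K)) := by
  obtain ⟨g, hg⟩ := MvPolynomial.exists_parallelGradient_eq_adjoin hC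
  have hsub := JacobianPoisson.center_subset_parallelGradient C
  have hgC : IsPolyRoot g C := by
    rw [IsPolyRoot, ← hg]
    exact MvPolynomial.self_mem_parallelGradient C
  have hcg : c ∈ Algebra.adjoin K {g} := by
    rw [← hg]
    exact hsub (JacobianPoisson.mem_center_of_isPolyRoot hc.1
      (Algebra.self_mem_adjoin_singleton K c))
  refine Set.Subset.antisymm ?_ fun a ha => JacobianPoisson.mem_center_of_isPolyRoot hc.1 ha
  rwa [MvPolynomial.adjoin_eq_of_isMinimalRoot hC hc hgC hcg, ← hg]
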